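/- All graphs are finite, simple and undirected. A graph with $n\ge 3$ vertices is \emph{optimal 1-planar} if it can be drawn in the plane with at most one crossing per edge and has $4n-8$ edges. For $k\ge 3$ the \emph{extended wheel graph} $XW_{2k}$ consists of a cycle of length $2k$, edges between the vertices at distance two on the cycle, and two nonadjacent poles, each joined to all vertices of the cycle. \emph{Reductions.} Let $G$ be a graph; a match is an injective map of vertices that preserves edges (further edges of $G$ between the matched vertices are allowed). $SR(x\mapsto x_4)$: $G$ has a vertex $x$ of degree six and distinct neighbours $x_1,\dots,x_6$ of $x$ such that $x_ix_{i+1}$ (indices modulo 6) and $x_1x_3,\ x_3x_5,\ x_5x_1$ are edges. It is feasible if none of $x_1x_4,\ x_2x_4,\ x_6x_4$ is an edge of $G$. It removes $x$ and the edge $x_3x_5$ and adds the edges $x_1x_4,\ x_2x_4,\ x_6x_4$. $CR(x_1,x_2,x_3,x_4)$: $G$ has distinct vertices $x_1,\dots,x_4,v_1,\dots,v_4$ such that every $x_i$ has degree six, the $x_i$ are pairwise adjacent, $x_i$ is adjacent to $v_{i-1},v_i,v_{i+1}$, and $v_iv_{i+1}$ is an edge (indices modulo 4). It is feasible if neither $v_1v_3$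 nor $v_2v_4$ is an edge of $G$. It removes $x_1,\dots,x_4$ and adds the edges $v_1v_3$ and $v_2v_4$. Write $G\to G'$ if $G'$ is isomorphic to the result of a feasible $SR$- or $CR$-reduction of $G$, and let $\to^*$ be the reflexive and transitive closure. For $m\ge 3$ let $N_m$ (the \emph{nested crossed quadrangles}) be the graph with vertices $u_{i,a}$, $0\le i<m$, $a\in\mathbb Z/4$, and edges $u_{i,a}u_{i,a+1}$ for all $i,a$; $u_{i,a}u_{i,a+2}$ for $i\in\{0,m-1\}$; and $u_{i,a}u_{i+1,b}$ for $0\le i<m-1$ and $b\in\{a-1,a,a+1\}$. \textbf{Theorem.} There are infinitely many optimal 1-planar graphs for which every reduction to an extended wheel graph ends at $XW_6$ and only $CR$-reductions can ever be applied. More precisely, the graphs $N_m$, $m\ge 3$, are pairwise non-isomorphic, and for every $m\ge 3$: (a) $N_m$ is optimal 1-planar; (b) $N_m\to^* XW_6$; (c) if $N_m\to^* XW_{2k}$ with $k\ge 3$, then $k=3$; (d) if $N_m\to^* H$, then $H$ is optimal 1-planar, no feasible $SR$-reduction exists for $H$, and either $H$ is isomorphic to $XW_6$ or there is a feasible $CR$-reduction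 of $H$. -/

import Mathlib

/-- The open arc of a curve parametrised by `[0, 1]`. -/
def openArc (γ : ℝ → ℝ × ℝ) : Set (ℝ × ℝ) := γ '' Set.Ioo 0 1

/-- A drawing of a simple graph in the plane in which every edge is crossed at most once.
Vertices are distinct points, every edge is a simple Jordan arc between its two endpoints that
contains no vertex in its interior, and a crossing of an edge `e` is a common interior point of
`e` and another edge. Only the values of `curve` at edges of `G` matter. -/
structure OnePlanarDrawing {V : Type} (G : SimpleGraph V) where
  pos : V → ℝ × ℝ
  curve : Sym2 V → ℝ → ℝ × ℝ
  pos_injective : Function.Injective pos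
  continuousOn : ∀ e ∈ G.edgeSet, ContinuousOn (curve e) (Set.Icc 0 1)
  injOn : ∀ e ∈ G.edgeSet, Set.InjOn (curve e) (Set.Icc 0 1)
  endpoints : ∀ e ∈ G.edgeSet, s(curve e 0, curve e 1) = e.map pos
  avoids_vertices : ∀ e ∈ G.edgeSet, ∀ v, pos v ∉ openArc (curve e)
  crossed_at_most_once : ∀ e ∈ G.edgeSet, ∀ f ∈ G.edgeSet, ∀ g ∈ G.edgeSet, f ≠ e → g ≠ e →
    ∀ p ∈ openArc (curve e) ∩ openArc (curve f), ∀ q ∈ openArc (curve e) ∩ openArc (curve g),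
      f = g ∧ p = q

/-- A graph is 1-planar if it has a drawing with at most one crossing per edge. -/
def IsOnePlanar {V : Type} (G : SimpleGraph V) : Prop := Nonempty (OnePlanarDrawing G)

/-- A finite 1-planar graph with `n ≥ 3` vertices is optimal if it has `4 n - 8` edges. -/
def IsOptimalOnePlanar {V : Type} (G : SimpleGraph V) : Prop :=
  Finite V ∧ 3 ≤ Nat.card V ∧ IsOnePlanar G ∧ G.edgeSet.ncard + 8 = 4 * Nat.card V

/-- The extended wheel graph `XW_{2k}` (for `k ≥ 3`): a cycle of length `2k`, edges between vertices
at distance two on the cycle, and two nonadjacent poles joined to all vertices of the cycle. -/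
def extendedWheel (k : ℕ) : SimpleGraph (ZMod (2 * k) ⊕ Bool) :=
  SimpleGraph.fromRel fun u w => match u, w with
    | .inl i, .inl j => j = i + 1 ∨ j = i + 2
    | .inl _, .inr _ => True
    | .inr _, _ => False

/-- The nested crossed quadrangles with `m` levels: every level is a 4-cycle, the space between
consecutive levels is divided into four kites (`b = a` gives the planar edges, `b = a + 1` and
`b = a - 1` the crossing ones), and the innermost and the outermost 4-cycle have both diagonals. -/
def nestedQuadrangles (m : ℕ) : SimpleGraph (Fin m × ZMod 4) :=
  SimpleGraph.fromRel fun u w => match u, w with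
    | (i, a), (j, b) =>
      (i = j ∧ b = a + 1) ∨
      (i = j ∧ (i.val = 0 ∨ i.val + 1 = m) ∧ b = a + 2) ∨
      (i.val + 1 = j.val ∧ (b = a ∨ b = a + 1 ∨ b = a - 1))

/-- The crossed star `CS`: the center `x` is `none`, its neighbours `x_1, …, x_6` are
`some 1, …, some 6` (indices modulo 6). It consists of the three kites with the planar
quadrilaterals `(x, x_1, x_2, x_3)`, `(x, x_3, x_4, x_5)`, `(x, x_5, x_6, x_1)`. -/
def crossedStar : SimpleGraph (Option (ZMod 6)) :=
  SimpleGraph.fromRel fun u w => match u, w with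
    | none, some _ => True
    | some i, some j => j = i + 1 ∨ (i = 1 ∧ j = 3) ∨ (i = 3 ∧ j = 5) ∨ (i = 5 ∧ j = 1)
    | _, none => False

/-- The crossed cube `CC` without diagonals in the outer face: the inner cycle `x_1, …, x_4` is
`Sum.inl`, the outer cycle `v_1, …, v_4` is `Sum.inr` (indices modulo 4). -/
def crossedCube : SimpleGraph (ZMod 4 ⊕ ZMod 4) :=
  SimpleGraph.fromRel fun u w => match u, w with
    | .inl i, .inl j => i ≠ j
    | .inl i, .inr j => j = i ∨ j = i + 1 ∨ j = i - 1
    | .inr i, .inr j => j = i + 1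
    | .inr _, .inl _ => False

/-- A candidate is a vertex of degree six. -/
def IsCandidate {V : Type} (G : SimpleGraph V) (x : V) : Prop := (G.neighborSet x).ncard = 6

/-- Feasibility of `SR(x ↦ x_4)` at a subgraph of `G` matched by the crossed star: the center is a
candidate and there is no blocking edge. The other two targets at `x` are covered by rotating the
match. -/
def SRFeasible {V : Type} {G : SimpleGraph V} (φ : SimpleGraph.Copy crossedStar G) : Prop :=
  IsCandidate G (φ none) ∧
    ¬ G.Adj (φ (some 2)) (φ (some 4)) ∧
    ¬ G.Adj (φ (some 6)) (φ (some 4)) ∧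
    ¬ G.Adj (φ (some 1)) (φ (some 4))

/-- The result of `SR(x ↦ x_4)`: `x` is removed and the crossed star is replaced by the two
adjacent kites with the planar quadrilaterals `(x_1, x_2, x_3, x_4)` and `(x_1, x_4, x_5, x_6)`. -/
def srResult {V : Type} {G : SimpleGraph V} (φ : SimpleGraph.Copy crossedStar G) :
    SimpleGraph {u : V | u ≠ φ none} :=
  (G.deleteEdges {s(φ (some 3), φ (some 5))} ⊔
    SimpleGraph.edge (φ (some 1)) (φ (some 4)) ⊔
    SimpleGraph.edge (φ (some 2)) (φ (some 4)) ⊔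
    SimpleGraph.edge (φ (some 6)) (φ (some 4))).induce {u : V | u ≠ φ none}

/-- Feasibility of `CR(x_1, x_2, x_3, x_4)` at a subgraph of `G` matched by the crossed cube: the
vertices of the inner cycle are candidates and there is no blocking edge. -/
def CRFeasible {V : Type} {G : SimpleGraph V} (φ : SimpleGraph.Copy crossedCube G) : Prop :=
  (∀ i : ZMod 4, IsCandidate G (φ (.inl i))) ∧
    ¬ G.Adj (φ (.inr 1)) (φ (.inr 3)) ∧
    ¬ G.Adj (φ (.inr 2)) (φ (.inr 4))

/-- The result of `CR(x_1, x_2, x_3, x_4)`: the inner cycle is removed and both diagonals of the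
outer cycle are added, so that the crossed cube is replaced by a kite. -/
def crResult {V : Type} {G : SimpleGraph V} (φ : SimpleGraph.Copy crossedCube G) :
    SimpleGraph {u : V | ∀ i : ZMod 4, u ≠ φ (.inl i)} :=
  (G ⊔ SimpleGraph.edge (φ (.inr 1)) (φ (.inr 3)) ⊔
    SimpleGraph.edge (φ (.inr 2)) (φ (.inr 4))).induce {u : V | ∀ i : ZMod 4, u ≠ φ (.inl i)}

/-- A simple graph together with its vertex type. -/
structure BundledGraph where
  V : Type
  graph : SimpleGraph V

/-- `A` reduces to `B` (up to isomorphism) by one feasible `SR`-reduction. -/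
def SRStep (A B : BundledGraph) : Prop :=
  ∃ φ : SimpleGraph.Copy crossedStar A.graph, SRFeasible φ ∧ Nonempty (srResult φ ≃g B.graph)

/-- `A` reduces to `B` (up to isomorphism) by one feasible `CR`-reduction. -/
def CRStep (A B : BundledGraph) : Prop :=
  ∃ φ : SimpleGraph.Copy crossedCube A.graph, CRFeasible φ ∧ Nonempty (crResult φ ≃g B.graph)

/-- The reflexive and transitive closure of the one-step reductions by `SR` or `CR`. -/
def Reduces : BundledGraph → BundledGraph → Prop :=
  Relation.ReflTransGen fun A B => SRStep A B ∨ CRStep A B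

/-! The family of all `nestedQuadrangles j` with `j ≥ 2` is closed under reduction, and its smallest
member is $XW_6$. Vertices on the two end levels have degree six and all others degree eight, so
only end levels contain candidates.

An $SR$-reduction is never feasible: nonadjacent neighbours of a candidate $x$ occupy opposite
positions in `ZMod 4`, so $x_1,x_2,x_6$ would share one position although the neighbours of $x$ lie
on only two levels (`not_srFeasible_nestedQuadrangles`). For at least three levels, the inner cycle
of a feasible $CR$-reduction must be a whole end level; its removal and the two new diagonals on the
next level give the same graph with one level less (`nonempty_crResult_iso`). With two levels the
graph is $K_8$ minus a perfect matching, that is, $XW_6$, and no $CR$-reduction is feasible.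

Hence every reachable graph is some `nestedQuadrangles j` with `j ≥ 2`
(`exists_iso_nestedQuadrangles_of_reduces`), and `j` can be decreased down to 2. Vertex count and
maximum degree exclude all extended wheels except $XW_6$. Optimality follows from the degree sum and
an explicit drawing with the levels on concentric circles. -/

/-- The level `i` is the innermost or the outermost one of `m` levels. -/
def IsEndLevel {m : ℕ} (i : Fin m) : Prop := i.val = 0 ∨ i.val + 1 = m

/-! ### Adjacency, degrees and number of edges -/

/-- The offsets -1, 0, 1 are all elements of `ZMod 4` except 2, so between consecutive levels only
opposite positions are nonadjacent. The later arguments use this symmetric form. -/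
lemma nestedQuadrangles_adj {m : ℕ} (u w : Fin m × ZMod 4) :
    (nestedQuadrangles m).Adj u w ↔
      (u.1 = w.1 ∧ (w.2 = u.2 + 1 ∨ w.2 = u.2 - 1 ∨ (IsEndLevel u.1 ∧ w.2 = u.2 + 2))) ∨
      ((u.1.val + 1 = w.1.val ∨ w.1.val + 1 = u.1.val) ∧ w.2 ≠ u.2 + 2) := by
  obtain ⟨i, a⟩ := u
  obtain ⟨j, b⟩ := w
  have h5 : (b = a + 1 ∨ b = a - 1 ∨ b = a + 2) ↔ ¬ a = b := by decide +revert
  have h1 : a = b + 1 ↔ b = a - 1 := by decide +revert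
  have h2 : a = b + 2 ↔ b = a + 2 := by clear h1 h5; decide +revert
  have h3 : (b = a ∨ b = a + 1 ∨ b = a - 1) ↔ ¬ b = a + 2 := by clear h1 h2 h5; decide +revert
  have h4 : (a = b ∨ a = b + 1 ∨ a = b - 1) ↔ ¬ b = a + 2 := by clear h1 h2 h3 h5; decide +revert
  simp only [nestedQuadrangles, SimpleGraph.fromRel_adj, ne_eq, Prod.mk.injEq, IsEndLevel]
  rw [h3, h4, h1, h2]
  clear h1 h2 h3 h4
  by_cases hij : i = j
  · subst hij
    simp only [true_and, Nat.add_eq_left, one_ne_zero, or_self, false_and, or_false]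
    generalize (b = a + 1) = P1 at *
    generalize (b = a - 1) = P2 at *
    generalize (b = a + 2) = P3 at *
    generalize (a = b) = P4 at *
    tauto
  · have : j ≠ i := fun h => hij h.symm
    simp only [hij, this, false_and, false_or, not_false_eq_true, true_and]
    generalize (b = a + 2) = P3
    tauto

lemma nestedQuadrangles_neighborSet {m : ℕ} (i : Fin m) (a : ZMod 4) :
    (nestedQuadrangles m).neighborSet (i, a) =
      ({i} ×ˢ {b | b = a + 1 ∨ b = a - 1 ∨ (IsEndLevel i ∧ b = a + 2)}) ∪
        ({j : Fin m | i.val + 1 = j.val ∨ j.val + 1 = i.val} ×ˢ {b | b ≠ a + 2}) := by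
  ext ⟨j, b⟩
  rw [SimpleGraph.mem_neighborSet, nestedQuadrangles_adj]
  simp [eq_comm]

lemma nestedQuadrangles_ncard_neighborSet {m : ℕ} (i : Fin m) (a : ZMod 4) :
    ((nestedQuadrangles m).neighborSet (i, a)).ncard =
      {b : ZMod 4 | b = a + 1 ∨ b = a - 1 ∨ (IsEndLevel i ∧ b = a + 2)}.ncard +
      {j : Fin m | i.val + 1 = j.val ∨ j.val + 1 = i.val}.ncard * 3 := by
  have h3 : {b : ZMod 4 | b ≠ a + 2}.ncard = 3 := by
    rw [Set.ncard_eq_toFinset_card']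
    decide +revert
  rw [nestedQuadrangles_neighborSet, Set.ncard_union_eq _ (Set.toFinite _) (Set.toFinite _),
    Set.ncard_prod, Set.ncard_prod, Set.ncard_singleton, h3, one_mul]
  rw [Set.disjoint_left]
  rintro ⟨j, b⟩ h h'
  simp only [Set.mem_prod, Set.mem_singleton_iff, Set.mem_ofPred_eq] at h h'
  rw [h.1] at h'
  omega

lemma degree_of_isEndLevel {m : ℕ} (hm : 2 ≤ m) {i : Fin m} (hi : IsEndLevel i) (a : ZMod 4) :
    ((nestedQuadrangles m).neighborSet (i, a)).ncard = 6 := by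
  have h1 : {b : ZMod 4 | b = a + 1 ∨ b = a - 1 ∨ (IsEndLevel i ∧ b = a + 2)}.ncard = 3 := by
    simp only [hi, true_and]
    rw [Set.ncard_eq_toFinset_card']
    decide +revert
  have h2 : {j : Fin m | i.val + 1 = j.val ∨ j.val + 1 = i.val}.ncard = 1 := by
    rw [Set.ncard_eq_one]
    rcases hi with hi | hi
    · refine ⟨⟨1, by omega⟩, ?_⟩
      ext j
      simp only [Set.mem_ofPred_eq, Set.mem_singleton_iff, Fin.ext_iff]
      omega
    · refine ⟨⟨m - 2, by omega⟩, ?_⟩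
      ext j
      simp only [Set.mem_ofPred_eq, Set.mem_singleton_iff, Fin.ext_iff]
      omega
  rw [nestedQuadrangles_ncard_neighborSet, h1, h2]

lemma degree_of_not_isEndLevel {m : ℕ} {i : Fin m} (hi : ¬ IsEndLevel i) (a : ZMod 4) :
    ((nestedQuadrangles m).neighborSet (i, a)).ncard = 8 := by
  have h1 : {b : ZMod 4 | b = a + 1 ∨ b = a - 1 ∨ (IsEndLevel i ∧ b = a + 2)}.ncard = 2 := by
    simp only [hi, false_and, or_false]
    rw [Set.ncard_eq_toFinset_card']
    decide +revert
  have h2 : {j : Fin m | i.val + 1 = j.val ∨ j.val + 1 = i.val}.ncard = 2 := by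
    rw [IsEndLevel] at hi
    rw [Set.ncard_eq_two]
    refine ⟨⟨i.val - 1, by omega⟩, ⟨i.val + 1, by omega⟩, ?_, ?_⟩
    · simp only [ne_eq, Fin.ext_iff]
      omega
    · ext j
      simp only [Set.mem_ofPred_eq, Set.mem_insert_iff, Set.mem_singleton_iff, Fin.ext_iff]
      omega
  rw [nestedQuadrangles_ncard_neighborSet, h1, h2]

lemma isCandidate_nestedQuadrangles_iff {m : ℕ} (hm : 2 ≤ m) (u : Fin m × ZMod 4) :
    IsCandidate (nestedQuadrangles m) u ↔ IsEndLevel u.1 := by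
  obtain ⟨i, a⟩ := u
  by_cases hi : IsEndLevel i
  · simp [IsCandidate, degree_of_isEndLevel hm hi, hi]
  · simp [IsCandidate, degree_of_not_isEndLevel hi, hi]

lemma nat_card_nestedQuadrangles (m : ℕ) : Nat.card (Fin m × ZMod 4) = 4 * m := by
  rw [Nat.card_prod, Nat.card_zmod, Nat.card_fin, mul_comm]

lemma ncard_edgeSet_nestedQuadrangles {m : ℕ} (hm : 2 ≤ m) :
    (nestedQuadrangles m).edgeSet.ncard + 8 = 4 * (4 * m) := by
  classical
  have h := (nestedQuadrangles m).sum_degrees_eq_twice_card_edges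
  -- The deficiency from degree eight is two on each end level. As `m ≥ 2`, the end levels are
  -- distinct and each contributes 8 to the total.
  have hdeg : ∀ u : Fin m × ZMod 4, (nestedQuadrangles m).degree u +
      ((if u.1.val = 0 then 2 else 0) + (if u.1.val = m - 1 then 2 else 0)) = 8 := by
    rintro ⟨i, a⟩
    rw [← SimpleGraph.card_neighborSet_eq_degree, ← Nat.card_eq_fintype_card,
      Nat.card_coe_set_eq]
    by_cases hi : IsEndLevel i
    · rw [degree_of_isEndLevel hm hi]
      rcases hi with hi | hi <;> dsimp only <;> split_ifs <;> omega
    · rw [degree_of_not_isEndLevel hi]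
      rw [IsEndLevel] at hi
      dsimp only
      split_ifs <;> omega
  have hsum := Finset.sum_congr (rfl : (Finset.univ : Finset (Fin m × ZMod 4)) = Finset.univ)
    (fun u _ => hdeg u)
  have hlevel : ∀ k, k < m → ∑ u : Fin m × ZMod 4, (if u.1.val = k then 2 else 0) = 8 := by
    intro k hk
    rw [Fintype.sum_prod_type]
    have : ∀ i : Fin m, (∑ _y : ZMod 4, if i.val = k then 2 else 0) =
        if i = ⟨k, hk⟩ then 8 else 0 := by
      intro i
      simp only [Fin.ext_iff]
      split_ifs <;> simp [ZMod.card]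
    simp only [this, Finset.sum_ite_eq', Finset.mem_univ, if_true]
  rw [Finset.sum_add_distrib, Finset.sum_add_distrib, hlevel 0 (by omega),
    hlevel (m - 1) (by omega), h, Finset.sum_const, Finset.card_univ, Fintype.card_prod,
    Fintype.card_fin, ZMod.card, smul_eq_mul] at hsum
  rw [Set.ncard_eq_toFinset_card', ← SimpleGraph.edgeFinset]
  omega

/-! ### A drawing in logarithmic polar coordinates -/

/-- The covering of the punctured plane by the plane of logarithmic polar coordinates, the angle
being measured in quarter turns. -/
noncomputable def polarMap (p : ℝ × ℝ) : ℝ × ℝ :=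
  (Real.exp p.1 * Real.cos (p.2 * (Real.pi / 2)), Real.exp p.1 * Real.sin (p.2 * (Real.pi / 2)))

lemma continuous_polarMap : Continuous polarMap := by
  unfold polarMap
  fun_prop

lemma polarMap_add_four (r t : ℝ) : polarMap (r, t + 4) = polarMap (r, t) := by
  have h : (t + 4) * (Real.pi / 2) = t * (Real.pi / 2) + 2 * Real.pi := by ring
  simp only [polarMap, h, Real.cos_add_two_pi, Real.sin_add_two_pi]

/-- `polarMap` is the complex exponential up to scaling the angle, so its period is 4 in the second
coordinate. -/
lemma eq_of_polarMap_eq {p q : ℝ × ℝ} (h : polarMap p = polarMap q) (hpq : |p.2 - q.2| < 4) :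
    p = q := by
  obtain ⟨r, t⟩ := p
  obtain ⟨r', t'⟩ := q
  have key : ∀ r t : ℝ, Complex.exp (⟨r, t * (Real.pi / 2)⟩ : ℂ) =
      ⟨(polarMap (r, t)).1, (polarMap (r, t)).2⟩ := by
    intro r t
    apply Complex.ext
    · simp [Complex.exp_re, polarMap]
    · simp [Complex.exp_im, polarMap]
  have h' := key r t
  rw [h, ← key, Complex.exp_eq_exp_iff_exists_int] at h'
  obtain ⟨n, hn⟩ := h'
  have hre := congrArg Complex.re hn
  have him := congrArg Complex.im hn
  simp at hre him
  have ht : t = t' + n * 4 := by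
    have : t * Real.pi = (t' + n * 4) * Real.pi := by linarith
    exact mul_right_cancel₀ Real.pi_ne_zero this
  have hn0 : n = 0 := by
    dsimp only at hpq
    rw [ht, abs_lt] at hpq
    have h1 : (-1 : ℝ) < n := by linarith
    have h2 : (n : ℝ) < 1 := by linarith
    have h1' : (-1 : ℤ) < n := by exact_mod_cast h1
    have h2' : n < (1 : ℤ) := by exact_mod_cast h2
    omega
  subst hn0
  simp at ht
  rw [hre, ht]

/-- The edges of the nested crossed quadrangles, by their position in the drawing. -/
inductive NestedEdge (m : ℕ) : Type
  | cycle (i : Fin m) (a : ZMod 4)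
  | radial (i j : Fin m) (h : i.val + 1 = j.val) (a : ZMod 4)
  | cross (i j : Fin m) (h : i.val + 1 = j.val) (a : ZMod 4) (b : Bool)
  | inner (i : Fin m) (h : i.val = 0) (b : Bool)
  | outer (i : Fin m) (h : i.val + 1 = m) (b : Bool)

namespace NestedEdge

variable {m : ℕ}

/-- The two endpoints of an edge. -/
def ends : NestedEdge m → Sym2 (Fin m × ZMod 4)
  | cycle i a => s((i, a), (i, a + 1))
  | radial i j _ a => s((i, a), (j, a))
  | cross i j _ a false => s((i, a), (j, a + 1))
  | cross i j _ a true => s((i, a + 1), (j, a))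
  | inner i _ false => s((i, 0), (i, 2))
  | inner i _ true => s((i, 1), (i, 3))
  | outer i _ false => s((i, 0), (i, 2))
  | outer i _ true => s((i, 1), (i, 3))

/-- The curve of an edge in logarithmic polar coordinates. -/
noncomputable def lift : NestedEdge m → ℝ → ℝ × ℝ
  | cycle i a, s => (i.val, a.val + s)
  | radial i _ _ a, s => (i.val + s, a.val)
  | cross i _ _ a false, s => (i.val + s, a.val + s)
  | cross i _ _ a true, s => (i.val + s, a.val + 1 - s)
  | inner _ _ false, s => (-(s * (1 - s)), 2 * s)
  | inner _ _ true, s => (-(s * (1 - s)), 1 + 2 * s)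
  | outer i _ false, s => (i.val + s * (1 - s), 2 * s)
  | outer i _ true, s => (i.val + s * (1 - s), 1 + 2 * s)

/-- The other edge of the same kite, if there is one. -/
def partner : NestedEdge m → NestedEdge m
  | cycle i a => cycle i a
  | radial i j h a => radial i j h a
  | cross i j h a b => cross i j h a (!b)
  | inner i h b => inner i h (!b)
  | outer i h b => outer i h (!b)

/-- The cell of the drawing in which the interior of an edge lies. -/
def cell : NestedEdge m → ℤ × Option ℤ
  | cycle i a => (2 * i.val, some (2 * a.val + 1))
  | radial i _ _ a => (2 * i.val + 1, some (2 * a.val))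
  | cross i _ _ a _ => (2 * i.val + 1, some (2 * a.val + 1))
  | inner _ _ _ => (-1, none)
  | outer i _ _ => (2 * i.val + 1, none)

/-- This turns the absence of unwanted crossings into integer bookkeeping: curves in different cells
are disjoint. -/
lemma eq_or_eq_partner_of_cell_eq {d e : NestedEdge m} (h : d.cell = e.cell) :
    d = e ∨ d = e.partner := by
  have hval : ∀ a b : ZMod 4, a.val = b.val → a = b := fun a b => (ZMod.val_injective 4 ·)
  cases d <;> cases e <;> simp only [cell, Prod.mk.injEq, Option.some.injEq, reduceCtorEq,
    and_false, and_true] at h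
  case cycle.cycle i a j b =>
    left
    rw [Fin.ext (by omega : i.val = j.val), hval a b (by omega)]
  case radial.radial i j hij a i' j' hij' a' =>
    left
    obtain rfl := Fin.ext (by omega : i.val = i'.val)
    obtain rfl := Fin.ext (by omega : j.val = j'.val)
    rw [hval a a' (by omega)]
  case cross.cross i j hij a b i' j' hij' a' b' =>
    obtain rfl := Fin.ext (by omega : i.val = i'.val)
    obtain rfl := Fin.ext (by omega : j.val = j'.val)
    obtain rfl := hval a a' (by omega)
    cases b <;> cases b' <;> simp [partner]
  case inner.inner i hi b i' hi' b' =>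
    obtain rfl := Fin.ext (by omega : i.val = i'.val)
    cases b <;> cases b' <;> simp [partner]
  case outer.outer i hi b i' hi' b' =>
    obtain rfl := Fin.ext (by omega : i.val = i'.val)
    cases b <;> cases b' <;> simp [partner]
  all_goals omega

end NestedEdge

/-- The number of the cell of a real number with respect to the subdivision of the line by the
integers: `2 n` for the integer `n` and `2 n + 1` for the interval between `n` and `n + 1`. -/
noncomputable def lineCell (x : ℝ) : ℤ := ⌊x⌋ + ⌈x⌉

lemma lineCell_natCast (n : ℕ) : lineCell n = 2 * n := by
  simp [lineCell, two_mul]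

lemma lineCell_of_mem_Ioo {x : ℝ} (n : ℤ) (h1 : n < x) (h2 : x < n + 1) :
    lineCell x = 2 * n + 1 := by
  have hf : ⌊x⌋ = n := Int.floor_eq_iff.2 ⟨h1.le, h2⟩
  have hc : ⌈x⌉ = n + 1 := Int.ceil_eq_iff.2 ⟨by push_cast; linarith, by push_cast; linarith⟩
  rw [lineCell, hf, hc]
  ring

/-- The cell of a point of the plane of logarithmic polar coordinates. -/
noncomputable def planeCell (m : ℕ) (p : ℝ × ℝ) : ℤ × Option ℤ :=
  (lineCell p.1, if lineCell p.1 = -1 ∨ lineCell p.1 = 2 * m - 1 then none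
    else some (lineCell p.2))

namespace NestedEdge

variable {m : ℕ}

/-- Every open arc stays within one cell. The strips beyond the end levels are not subdivided by
angle, because the diagonals drawn there sweep over half a turn. -/
lemma planeCell_lift (d : NestedEdge m) {s : ℝ} (hs : s ∈ Set.Ioo (0 : ℝ) 1) :
    planeCell m (d.lift s) = d.cell := by
  obtain ⟨h0, h1⟩ := hs
  have hmul : 0 < s * (1 - s) := mul_pos h0 (by linarith)
  have hmul' : s * (1 - s) < 1 := by nlinarith
  have up : ∀ n : ℕ, lineCell (n + s) = 2 * n + 1 := fun n =>
    lineCell_of_mem_Ioo (n : ℤ) (by push_cast; linarith) (by push_cast; linarith)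
  have down : ∀ n : ℕ, lineCell (n + 1 - s) = 2 * n + 1 := fun n =>
    lineCell_of_mem_Ioo (n : ℤ) (by push_cast; linarith) (by push_cast; linarith)
  have out : ∀ n : ℕ, lineCell (n + s * (1 - s)) = 2 * n + 1 := fun n =>
    lineCell_of_mem_Ioo (n : ℤ) (by push_cast; linarith) (by push_cast; linarith)
  have inn : lineCell (-(s * (1 - s))) = -1 :=
    lineCell_of_mem_Ioo (-1) (by push_cast; linarith) (by push_cast; linarith)
  cases d with
  | cycle i a =>
    have := i.isLt
    simp only [lift, cell, planeCell, lineCell_natCast, up]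
    rw [if_neg (by omega)]
  | radial i j h a =>
    have := j.isLt
    simp only [lift, cell, planeCell, lineCell_natCast, up]
    rw [if_neg (by omega)]
  | cross i j h a b =>
    have := j.isLt
    cases b <;> simp only [lift, cell, planeCell, up, down] <;> rw [if_neg (by omega)]
  | inner i h b =>
    cases b <;> simp [lift, cell, planeCell, inn]
  | outer i h b =>
    cases b <;> simp only [lift, cell, planeCell, out] <;> rw [if_pos (by omega)]

lemma lift_snd_mem (d : NestedEdge m) {s : ℝ} (hs : s ∈ Set.Ioo (0 : ℝ) 1) :
    (d.lift s).2 ∈ Set.Ico (0 : ℝ) 4 := by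
  obtain ⟨h0, h1⟩ := hs
  have hv : ∀ a : ZMod 4, (0 : ℝ) ≤ a.val ∧ (a.val : ℝ) ≤ 3 := fun a =>
    ⟨by positivity, by exact_mod_cast Nat.le_of_lt_succ (ZMod.val_lt a)⟩
  cases d with
  | cycle i a => simp only [lift, Set.mem_Ico]; constructor <;> linarith [hv a]
  | radial i j h a => simp only [lift, Set.mem_Ico]; constructor <;> linarith [hv a]
  | cross i j h a b =>
    cases b <;> simp only [lift, Set.mem_Ico] <;> constructor <;> linarith [hv a]
  | inner i h b => cases b <;> simp only [lift, Set.mem_Ico] <;> constructor <;> linarith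
  | outer i h b => cases b <;> simp only [lift, Set.mem_Ico] <;> constructor <;> linarith

lemma continuous_lift (d : NestedEdge m) : Continuous d.lift := by
  refine Continuous.prodMk (f := fun s => (d.lift s).1) (g := fun s => (d.lift s).2) ?_ ?_
  · cases d with
    | cycle i a => simp only [lift]; fun_prop
    | radial i j h a => simp only [lift]; fun_prop
    | cross i j h a b => cases b <;> simp only [lift] <;> fun_prop
    | inner i h b => cases b <;> simp only [lift] <;> fun_prop
    | outer i h b => cases b <;> simp only [lift] <;> fun_prop
  · cases d with
    | cycle i a => simp only [lift]; fun_prop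
    | radial i j h a => simp only [lift]; fun_prop
    | cross i j h a b => cases b <;> simp only [lift] <;> fun_prop
    | inner i h b => cases b <;> simp only [lift] <;> fun_prop
    | outer i h b => cases b <;> simp only [lift] <;> fun_prop

lemma lift_injective (d : NestedEdge m) : Function.Injective d.lift := by
  intro s t h
  cases d with
  | cycle i a => simpa [lift] using h
  | radial i j h a => simpa [lift] using h
  | cross i j h a b => cases b <;> simpa [lift] using h
  | inner i h b => cases b <;> simp [lift] at h <;> exact h.2
  | outer i h b => cases b <;> simp [lift] at h <;> exact h.2

lemma abs_lift_snd_sub_lt (d : NestedEdge m) {s t : ℝ} (hs : s ∈ Set.Icc (0 : ℝ) 1)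
    (ht : t ∈ Set.Icc (0 : ℝ) 1) : |(d.lift s).2 - (d.lift t).2| < 4 := by
  obtain ⟨h0, h1⟩ := hs
  obtain ⟨h2, h3⟩ := ht
  rw [abs_lt]
  cases d with
  | cycle i a => simp only [lift]; constructor <;> linarith
  | radial i j h a => simp only [lift]; constructor <;> linarith
  | cross i j h a b => cases b <;> simp only [lift] <;> constructor <;> linarith
  | inner i h b => cases b <;> simp only [lift] <;> constructor <;> linarith
  | outer i h b => cases b <;> simp only [lift] <;> constructor <;> linarith

lemma crossing_unique (d : NestedEdge m) (hd : d ≠ d.partner) {s s' t t' : ℝ}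
    (h : d.lift s = d.partner.lift s') (h' : d.lift t = d.partner.lift t') : s = t := by
  cases d with
  | cycle i a => exact absurd rfl hd
  | radial i j h a => exact absurd rfl hd
  | cross i j hij a b =>
    cases b <;> simp only [lift, partner, Prod.mk.injEq, Bool.not_true, Bool.not_false] at h h' <;>
      linarith
  | inner i hi b =>
    cases b <;> simp only [lift, partner, Prod.mk.injEq, Bool.not_true, Bool.not_false] at h h' <;>
      obtain ⟨h1, h2⟩ := h <;> obtain ⟨h3, h4⟩ := h'
    -- After the angle equation is substituted, the quadratic terms of the radius equation cancel,
    -- which leaves a linear equation for the parameter.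
    · obtain rfl : s = s' + 1 / 2 := by linarith
      obtain rfl : t = t' + 1 / 2 := by linarith
      linarith
    · obtain rfl : s' = s + 1 / 2 := by linarith
      obtain rfl : t' = t + 1 / 2 := by linarith
      linarith
  | outer i hi b =>
    cases b <;> simp only [lift, partner, Prod.mk.injEq, Bool.not_true, Bool.not_false] at h h' <;>
      obtain ⟨h1, h2⟩ := h <;> obtain ⟨h3, h4⟩ := h'
    · obtain rfl : s = s' + 1 / 2 := by linarith
      obtain rfl : t = t' + 1 / 2 := by linarith
      linarith
    · obtain rfl : s' = s + 1 / 2 := by linarith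
      obtain rfl : t' = t + 1 / 2 := by linarith
      linarith

/-- The curve of an edge in the plane. -/
noncomputable def arc (d : NestedEdge m) (s : ℝ) : ℝ × ℝ := polarMap (d.lift s)

/-- The angles on lifted open arcs lie in `[0, 4)`, where `polarMap` is injective, so intersections
in the plane lift to intersections of the lifts. -/
lemma exists_of_arc_inter {d e : NestedEdge m} {p : ℝ × ℝ} (hd : p ∈ openArc d.arc)
    (he : p ∈ openArc e.arc) :
    ∃ s ∈ Set.Ioo (0 : ℝ) 1, ∃ t ∈ Set.Ioo (0 : ℝ) 1, p = d.arc s ∧ d.lift s = e.lift t := by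
  obtain ⟨s, hs, rfl⟩ := hd
  obtain ⟨t, ht, h⟩ := he
  refine ⟨s, hs, t, ht, rfl, eq_of_polarMap_eq h.symm ?_⟩
  have h1 := d.lift_snd_mem hs
  have h2 := e.lift_snd_mem ht
  rw [abs_lt]
  constructor <;> linarith [h1.1, h1.2, h2.1, h2.2]

end NestedEdge

/-- The position of a vertex in the drawing. -/
noncomputable def nestedPos {m : ℕ} (u : Fin m × ZMod 4) : ℝ × ℝ :=
  polarMap (u.1.val, u.2.val)

lemma nestedPos_add_one {m : ℕ} (i : Fin m) (a : ZMod 4) :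
    nestedPos (i, a + 1) = polarMap (i.val, a.val + 1) := by
  -- In the wrap-around case `a = 3` the two angles differ by a full turn.
  have h : (a + 1).val = a.val + 1 ∨ (a.val + 1 = (a + 1).val + 4) := by decide +revert
  unfold nestedPos
  rcases h with h | h
  · simp [h]
  · have h' : (a.val : ℝ) + 1 = (a + 1).val + 4 := by exact_mod_cast h
    simp only [h', polarMap_add_four]

lemma nestedPos_injective {m : ℕ} : Function.Injective (nestedPos (m := m)) := by
  rintro ⟨i, a⟩ ⟨j, b⟩ h
  have ha : (a.val : ℝ) < 4 := by exact_mod_cast ZMod.val_lt a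
  have hb : (b.val : ℝ) < 4 := by exact_mod_cast ZMod.val_lt b
  have ha0 : (0 : ℝ) ≤ a.val := by positivity
  have hb0 : (0 : ℝ) ≤ b.val := by positivity
  have := eq_of_polarMap_eq h (by rw [abs_lt]; constructor <;> dsimp only <;> linarith)
  simp only [Prod.mk.injEq, Nat.cast_inj] at this
  rw [Fin.ext this.1, ZMod.val_injective 4 this.2]

lemma NestedEdge.arc_endpoints {m : ℕ} (d : NestedEdge m) :
    s(d.arc 0, d.arc 1) = d.ends.map nestedPos := by
  have v0 : ZMod.val (0 : ZMod 4) = 0 := by decide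
  have v1 : ZMod.val (1 : ZMod 4) = 1 := by decide
  have v2 : ZMod.val (2 : ZMod 4) = 2 := by decide
  have v3 : ZMod.val (3 : ZMod 4) = 3 := by decide
  cases d with
  | cycle i a =>
    simp only [ends, Sym2.map_mk, nestedPos_add_one, arc, lift]
    simp [nestedPos]
  | radial i j h a =>
    simp only [ends, Sym2.map_mk, arc, lift]
    simp [nestedPos, ← h]
  | cross i j h a b =>
    cases b <;> simp only [ends, Sym2.map_mk, nestedPos_add_one, arc, lift] <;>
      simp [nestedPos, ← h]
  | inner i h b =>
    cases b <;> simp only [ends, Sym2.map_mk, arc, lift, nestedPos, v0, v1, v2, v3, h] <;>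
      norm_num
  | outer i h b =>
    cases b <;> simp only [ends, Sym2.map_mk, arc, lift, nestedPos, v0, v1, v2, v3] <;>
      norm_num

/-- Both cell coordinates of a vertex are even, whereas the cell of an edge has an odd coordinate.
-/
lemma NestedEdge.nestedPos_notMem_openArc {m : ℕ} (d : NestedEdge m) (u : Fin m × ZMod 4) :
    nestedPos u ∉ openArc d.arc := by
  rintro ⟨s, hs, h⟩
  have hu : (u.2.val : ℝ) < 4 := by exact_mod_cast ZMod.val_lt u.2
  have hu0 : (0 : ℝ) ≤ u.2.val := by positivity
  have h1 := d.lift_snd_mem hs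
  have h2 : d.lift s = ((u.1.val : ℝ), (u.2.val : ℝ)) := eq_of_polarMap_eq h (by
    rw [abs_lt]
    constructor <;> dsimp only <;> linarith [h1.1, h1.2])
  have h3 := d.planeCell_lift hs
  have := u.1.isLt
  rw [h2, planeCell] at h3
  simp only [lineCell_natCast] at h3
  rw [if_neg (by omega)] at h3
  cases d <;> simp only [cell, Prod.mk.injEq, Option.some.injEq, reduceCtorEq,
    and_false] at h3 <;> omega

lemma NestedEdge.exists_ends_eq {m : ℕ} {e : Sym2 (Fin m × ZMod 4)}
    (he : e ∈ (nestedQuadrangles m).edgeSet) : ∃ d : NestedEdge m, d.ends = e := by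
  induction e using Sym2.ind with
  | _ u w =>
  obtain ⟨i, a⟩ := u
  obtain ⟨j, b⟩ := w
  have sub : ∀ x y : ZMod 4, y = x - 1 → x = y + 1 := by decide
  have diag : ∀ x y : ZMod 4, y = x + 2 → (x = 0 ∧ y = 2) ∨ (x = 1 ∧ y = 3) ∨ (x = 2 ∧ y = 0) ∨
      (x = 3 ∧ y = 1) := by decide
  have three : ∀ x y : ZMod 4, y ≠ x + 2 → y = x ∨ y = x + 1 ∨ x = y + 1 := by decide
  have opp : ∀ x y : ZMod 4, y ≠ x + 2 → x ≠ y + 2 := by decide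
  have up : ∀ (i j : Fin m) (a b : ZMod 4), i.val + 1 = j.val → b ≠ a + 2 →
      ∃ d : NestedEdge m, d.ends = s((i, a), (j, b)) := by
    intro i j a b hij hab
    rcases three a b hab with h | h | h
    · exact ⟨radial i j hij a, by rw [h]; rfl⟩
    · exact ⟨cross i j hij a false, by rw [h]; rfl⟩
    · exact ⟨cross i j hij b true, by rw [h]; rfl⟩
  rw [SimpleGraph.mem_edgeSet, nestedQuadrangles_adj] at he
  rcases he with ⟨hij, h⟩ | ⟨hij, h⟩
  · dsimp only at hij h
    subst hij
    rcases h with h | h | ⟨hi, h⟩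
    · exact ⟨cycle i a, by rw [h]; rfl⟩
    · exact ⟨cycle i b, by rw [sub a b h, Sym2.eq_swap]; rfl⟩
    · rcases hi with hi | hi <;>
        rcases diag a b h with ⟨h1, h2⟩ | ⟨h1, h2⟩ | ⟨h1, h2⟩ | ⟨h1, h2⟩ <;> rw [h1, h2]
      · exact ⟨inner i hi false, rfl⟩
      · exact ⟨inner i hi true, rfl⟩
      · exact ⟨inner i hi false, Sym2.eq_swap⟩
      · exact ⟨inner i hi true, Sym2.eq_swap⟩
      · exact ⟨outer i hi false, rfl⟩
      · exact ⟨outer i hi true, rfl⟩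
      · exact ⟨outer i hi false, Sym2.eq_swap⟩
      · exact ⟨outer i hi true, Sym2.eq_swap⟩
  · dsimp only at hij h
    rcases hij with hij | hij
    · exact up i j a b hij h
    · rw [Sym2.eq_swap]
      exact up j i b a hij (opp a b h)

lemma isOnePlanar_nestedQuadrangles (m : ℕ) : IsOnePlanar (nestedQuadrangles m) := by
  classical
  -- The implication is placed inside the existential so that `choose` yields a total function; the
  -- zero curve for non-edges is irrelevant.
  have hex : ∀ e : Sym2 (Fin m × ZMod 4), ∃ γ : ℝ → ℝ × ℝ, e ∈ (nestedQuadrangles m).edgeSet →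
      ∃ d : NestedEdge m, d.ends = e ∧ γ = d.arc := by
    intro e
    by_cases he : e ∈ (nestedQuadrangles m).edgeSet
    · obtain ⟨d, hd⟩ := NestedEdge.exists_ends_eq he
      exact ⟨d.arc, fun _ => ⟨d, hd, rfl⟩⟩
    · exact ⟨fun _ => 0, fun h => absurd h he⟩
  choose curve hcurve using hex
  refine ⟨⟨nestedPos, curve, nestedPos_injective, ?_, ?_, ?_, ?_, ?_⟩⟩
  · intro e he
    obtain ⟨d, -, hd⟩ := hcurve e he
    rw [hd]
    exact (continuous_polarMap.comp d.continuous_lift).continuousOn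
  · intro e he
    obtain ⟨d, -, hd⟩ := hcurve e he
    rw [hd]
    intro s hs t ht h
    exact d.lift_injective (eq_of_polarMap_eq h (d.abs_lift_snd_sub_lt hs ht))
  · intro e he
    obtain ⟨d, hde, hd⟩ := hcurve e he
    rw [hd, d.arc_endpoints, hde]
  · intro e he u
    obtain ⟨d, -, hd⟩ := hcurve e he
    rw [hd]
    exact d.nestedPos_notMem_openArc u
  · intro e he f hf g hg hfe hge p hp q hq
    obtain ⟨d, hde, hd⟩ := hcurve e he
    obtain ⟨d', hde', hd'⟩ := hcurve f hf
    obtain ⟨d'', hde'', hd''⟩ := hcurve g hg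
    rw [hd, hd'] at hp
    rw [hd, hd''] at hq
    obtain ⟨s, hs, s', hs', rfl, h1⟩ := NestedEdge.exists_of_arc_inter hp.1 hp.2
    obtain ⟨t, ht, t', ht', rfl, h2⟩ := NestedEdge.exists_of_arc_inter hq.1 hq.2
    have hpart : ∀ {c : NestedEdge m} {x x' : ℝ}, x ∈ Set.Ioo (0 : ℝ) 1 → x' ∈ Set.Ioo (0 : ℝ) 1 →
        d.lift x = c.lift x' → c.ends ≠ d.ends → c = d.partner := by
      intro c x x' hx hx' h hne
      have hc : c.cell = d.cell := by
        rw [← c.planeCell_lift hx', ← d.planeCell_lift hx, h]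
      exact (NestedEdge.eq_or_eq_partner_of_cell_eq hc).resolve_left fun h => hne (by rw [h])
    have e1 : d' = d.partner := hpart hs hs' h1 (by rwa [hde, hde'])
    have e2 : d'' = d.partner := hpart ht ht' h2 (by rwa [hde, hde''])
    refine ⟨by rw [← hde', ← hde'', e1, e2], ?_⟩
    rw [e1] at h1
    rw [e2] at h2
    rw [d.crossing_unique (fun h => hfe ?_) h1 h2]
    rw [← hde, ← hde', e1, ← h]

lemma isOptimalOnePlanar_nestedQuadrangles {m : ℕ} (hm : 2 ≤ m) :
    IsOptimalOnePlanar (nestedQuadrangles m) := by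
  refine ⟨inferInstance, ?_, isOnePlanar_nestedQuadrangles m, ?_⟩
  · rw [nat_card_nestedQuadrangles]
    omega
  · rw [nat_card_nestedQuadrangles, ncard_edgeSet_nestedQuadrangles hm]

/-! ### Invariance under isomorphism -/

section Iso

variable {V W : Type} {G : SimpleGraph V} {H : SimpleGraph W}

lemma IsOnePlanar.of_iso (e : H ≃g G) (h : IsOnePlanar G) : IsOnePlanar H := by
  obtain ⟨D⟩ := h
  have hmem : ∀ x ∈ H.edgeSet, x.map e ∈ G.edgeSet := by
    intro x hx
    induction x using Sym2.ind with
    | _ u w => exact e.map_adj_iff.2 hx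
  have hinj : Function.Injective (Sym2.map e) := Sym2.map.injective e.injective
  refine ⟨⟨D.pos ∘ e, fun x => D.curve (x.map e), D.pos_injective.comp e.injective, ?_, ?_, ?_,
    ?_, ?_⟩⟩
  · exact fun x hx => D.continuousOn _ (hmem x hx)
  · exact fun x hx => D.injOn _ (hmem x hx)
  · intro x hx
    rw [D.endpoints _ (hmem x hx), Sym2.map_map]
  · exact fun x hx v => D.avoids_vertices _ (hmem x hx) (e v)
  · intro x hx y hy z hz hyx hzx p hp q hq
    have := D.crossed_at_most_once _ (hmem x hx) _ (hmem y hy) _ (hmem z hz)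
      (fun h => hyx (hinj h)) (fun h => hzx (hinj h)) p hp q hq
    exact ⟨hinj this.1, this.2⟩

lemma IsOptimalOnePlanar.of_iso (e : H ≃g G) (h : IsOptimalOnePlanar G) :
    IsOptimalOnePlanar H := by
  obtain ⟨hfin, hcard, hplanar, hedges⟩ := h
  have hV : Nat.card W = Nat.card V := Nat.card_congr e.toEquiv
  have hE : H.edgeSet.ncard = G.edgeSet.ncard := Nat.card_congr e.mapEdgeSet
  refine ⟨Finite.of_equiv V e.symm.toEquiv, by rwa [hV], hplanar.of_iso e, ?_⟩
  rw [hE, hV, hedges]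

lemma ncard_neighborSet_iso (e : H ≃g G) (u : W) :
    (G.neighborSet (e u)).ncard = (H.neighborSet u).ncard :=
  (Nat.card_congr (e.mapNeighborSet u)).symm

lemma isCandidate_iso (e : H ≃g G) (u : W) : IsCandidate G (e u) ↔ IsCandidate H u := by
  rw [IsCandidate, IsCandidate, ncard_neighborSet_iso]

/-- The image of a copy under an isomorphism. -/
def SimpleGraph.Copy.mapIso {U : Type} {F : SimpleGraph U} (φ : SimpleGraph.Copy F H)
    (e : H ≃g G) : SimpleGraph.Copy F G :=
  ⟨e.toHom.comp φ.toHom, e.injective.comp φ.injective⟩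

lemma SimpleGraph.Copy.mapIso_apply {U : Type} {F : SimpleGraph U} (φ : SimpleGraph.Copy F H)
    (e : H ≃g G) (u : U) : φ.mapIso e u = e (φ u) := rfl

lemma SRFeasible.mapIso {φ : SimpleGraph.Copy crossedStar H} (hφ : SRFeasible φ) (e : H ≃g G) :
    SRFeasible (φ.mapIso e) := by
  simpa only [SRFeasible, SimpleGraph.Copy.mapIso_apply, isCandidate_iso, e.map_adj_iff] using hφ

lemma CRFeasible.mapIso {φ : SimpleGraph.Copy crossedCube H} (hφ : CRFeasible φ) (e : H ≃g G) :
    CRFeasible (φ.mapIso e) := by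
  simpa only [CRFeasible, SimpleGraph.Copy.mapIso_apply, isCandidate_iso, e.map_adj_iff] using hφ

/-- The results of a `CR`-reduction and of its image under an isomorphism are isomorphic. -/
def crResultIso (φ : SimpleGraph.Copy crossedCube H) (e : H ≃g G) :
    crResult φ ≃g crResult (φ.mapIso e) where
  toEquiv := e.toEquiv.subtypeEquiv fun u => forall_congr' fun i => by
    rw [SimpleGraph.Copy.mapIso_apply]
    exact not_congr e.injective.eq_iff.symm
  map_rel_iff' := by
    rintro ⟨u, hu⟩ ⟨w, hw⟩
    change ((G ⊔ SimpleGraph.edge _ _ ⊔ SimpleGraph.edge _ _).Adj (e u) (e w)) ↔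
      ((H ⊔ SimpleGraph.edge _ _ ⊔ SimpleGraph.edge _ _).Adj u w)
    simp only [SimpleGraph.sup_adj, SimpleGraph.edge_adj, SimpleGraph.Copy.mapIso_apply,
      e.map_adj_iff, e.injective.eq_iff, ne_eq]

end Iso

/-! ### No feasible $SR$-reduction -/

lemma not_srFeasible_nestedQuadrangles {m : ℕ} (hm : 2 ≤ m)
    (φ : SimpleGraph.Copy crossedStar (nestedQuadrangles m)) : ¬ SRFeasible φ := by
  rintro ⟨hx, h2, h6, h1⟩
  rw [isCandidate_nestedQuadrangles_iff hm] at hx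
  have hadj : ∀ i, (nestedQuadrangles m).Adj (φ none) (φ (some i)) := fun i =>
    φ.toHom.map_adj (by simp [crossedStar])
  have hne : ∀ i j : ZMod 6, i ≠ j → φ (some i) ≠ φ (some j) := fun i j hij h =>
    hij (Option.some_injective _ (φ.injective h))
  -- All neighbours of a vertex on an end level lie on that level and the single level next to it,
  -- so two of them on different levels are on consecutive ones.
  have hlevel : ∀ y z, (nestedQuadrangles m).Adj (φ none) y →
      (nestedQuadrangles m).Adj (φ none) z → y ≠ z → ¬ (nestedQuadrangles m).Adj y z →
      y.2 = z.2 + 2 := by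
    rintro ⟨i, a⟩ ⟨j, b⟩ hy hz hyz hn
    generalize φ none = x at hx hy hz
    obtain ⟨k, c⟩ := x
    simp only [nestedQuadrangles_adj, IsEndLevel] at hx hy hz hn
    have hZ : ∀ a b : ZMod 4, ¬ a = b + 2 → ¬ a = b → b = a + 1 ∨ b = a - 1 := by decide
    have hZ' : ∀ a b : ZMod 4, b = a + 2 → a = b + 2 := by decide
    by_contra hab
    by_cases hij : i = j
    · exact hn (Or.inl ⟨hij, (hZ a b hab fun h => hyz (by rw [hij, h])).imp_right Or.inl⟩)
    · refine hn (Or.inr ⟨?_, fun h => hab (hZ' a b h)⟩)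
      rw [Fin.ext_iff] at hij hy hz
      omega
  have e2 := hlevel _ _ (hadj 2) (hadj 4) (hne _ _ (by decide)) h2
  have e6 := hlevel _ _ (hadj 6) (hadj 4) (hne _ _ (by decide)) h6
  have e1 := hlevel _ _ (hadj 1) (hadj 4) (hne _ _ (by decide)) h1
  have hdiff : ∀ i j : ZMod 6, i ≠ j → (φ (some i)).2 = (φ (some j)).2 →
      (φ (some i)).1.val ≠ (φ (some j)).1.val := fun i j hij h h' =>
    hne i j hij (Prod.ext (Fin.ext h') h)
  have d12 := hdiff 1 2 (by decide) (e1.trans e2.symm)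
  have d16 := hdiff 1 6 (by decide) (e1.trans e6.symm)
  have d26 := hdiff 2 6 (by decide) (e2.trans e6.symm)
  have a1 := hadj 1
  have a2 := hadj 2
  have a6 := hadj 6
  simp only [nestedQuadrangles_adj, IsEndLevel, Fin.ext_iff] at hx a1 a2 a6
  have := (φ (some 1)).1.isLt
  have := (φ (some 2)).1.isLt
  have := (φ (some 6)).1.isLt
  -- Three pairwise distinct levels would have to be among the two available ones.
  omega

/-! ### $CR$-reductions remove an end level -/

/-- The automorphism that reverses the order of the levels. -/
def reverseLevels (m : ℕ) : nestedQuadrangles m ≃g nestedQuadrangles m where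
  toEquiv := Fin.revPerm.prodCongr (Equiv.refl _)
  map_rel_iff' := by
    rintro ⟨i, a⟩ ⟨j, b⟩
    have h1 : (Fin.rev i = Fin.rev j) ↔ i = j := Fin.rev_inj
    have h2 : (i.rev.val = 0 ∨ i.rev.val + 1 = m) ↔ (i.val = 0 ∨ i.val + 1 = m) := by
      rw [Fin.val_rev]
      omega
    have h3 : (i.rev.val + 1 = j.rev.val ∨ j.rev.val + 1 = i.rev.val) ↔
        (i.val + 1 = j.val ∨ j.val + 1 = i.val) := by
      rw [Fin.val_rev, Fin.val_rev]
      omega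
    simp only [nestedQuadrangles_adj, IsEndLevel, Equiv.prodCongr_apply, Prod.map_apply,
      Fin.revPerm_apply, Equiv.refl_apply, h1, h2, h3]

lemma crossedCube_inl_adj {i j : ZMod 4} (h : i ≠ j) : crossedCube.Adj (.inl i) (.inl j) := by
  simp [crossedCube, h]

lemma crossedCube_inl_inr_adj (i : ZMod 4) : crossedCube.Adj (.inl i) (.inr i) := by
  simp [crossedCube]

/-- Without the last level, level `k - 1` becomes an end level and acquires its diagonals. -/
lemma nestedQuadrangles_adj_restrict {k : ℕ} (hk : 2 ≤ k) {i j : Fin (k + 1)} (hi : i.val < k)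
    (hj : j.val < k) (a b : ZMod 4) :
    (nestedQuadrangles k).Adj (⟨i.val, hi⟩, a) (⟨j.val, hj⟩, b) ↔
      (nestedQuadrangles (k + 1)).Adj (i, a) (j, b) ∨
        ((i.val = k - 1 ∧ j.val = k - 1) ∧ b = a + 2) := by
  rw [nestedQuadrangles_adj, nestedQuadrangles_adj]
  simp only [IsEndLevel, Fin.ext_iff]
  generalize (b = a + 1) = P1
  generalize (b = a - 1) = P2
  generalize (b ≠ a + 2) = P4
  generalize (b = a + 2) = P3
  by_cases hij : i.val = j.val
  · have h1 : ¬ i.val + 1 = k + 1 := by omega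
    have h2 : j.val = k - 1 ↔ i.val + 1 = k := by omega
    have h3 : ¬ (i.val + 1 = j.val ∨ j.val + 1 = i.val) := by omega
    rw [hij] at h1 h2 h3
    simp only [hij, true_and, h1, h2, h3, or_false, false_and, and_self]
    tauto
  · have h : ¬ (i.val = k - 1 ∧ j.val = k - 1) := by omega
    simp only [hij, h, false_and, false_or, or_false]

lemma edge_adj_of_opposite {k : ℕ} {x y : Fin (k + 1) × ZMod 4} {n : ℕ} (hx : x.1.val = n)
    (hy : y.1.val = n) (hxy : y.2 = x.2 + 2) (i j : Fin (k + 1)) (a b : ZMod 4) :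
    (SimpleGraph.edge x y).Adj (i, a) (j, b) ↔
      (i.val = n ∧ j.val = n) ∧ b = a + 2 ∧ (a = x.2 ∨ a = x.2 + 2) := by
  obtain ⟨x1, x2⟩ := x
  obtain ⟨y1, y2⟩ := y
  dsimp only at hx hy hxy
  subst hxy
  rw [SimpleGraph.edge_adj]
  simp only [Prod.mk.injEq, Fin.ext_iff, hx, hy, ne_eq]
  have hZ : ∀ x a b : ZMod 4, (a = x ∧ b = x + 2 ∨ a = x + 2 ∧ b = x) ↔
      b = a + 2 ∧ (a = x ∨ a = x + 2) := by decide
  have hZ' : ∀ a b : ZMod 4, b = a + 2 → ¬ a = b := by decide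
  rw [← hZ]
  constructor
  · rintro ⟨⟨⟨h1, h2⟩, h3, h4⟩ | ⟨⟨h1, h2⟩, h3, h4⟩, -⟩
    · exact ⟨⟨h1, h3⟩, Or.inl ⟨h2, h4⟩⟩
    · exact ⟨⟨h1, h3⟩, Or.inr ⟨h2, h4⟩⟩
  · rintro ⟨⟨h1, h3⟩, h⟩
    refine ⟨?_, fun h' => hZ' a b ((hZ _ _ _).1 h).1 h'.2⟩
    rcases h with ⟨h2, h4⟩ | ⟨h2, h4⟩
    · exact Or.inl ⟨⟨h1, h2⟩, h3, h4⟩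
    · exact Or.inr ⟨⟨h1, h2⟩, h3, h4⟩

/-- A feasible `CR`-reduction that removes the outermost level leads to the nested crossed
quadrangles with one level less. -/
lemma nonempty_crResult_iso_of_last {k : ℕ} (hk : 2 ≤ k)
    (φ : SimpleGraph.Copy crossedCube (nestedQuadrangles (k + 1))) (hφ : CRFeasible φ)
    (hlast : ∀ i, (φ (.inl i)).1.val = k) :
    Nonempty (crResult φ ≃g nestedQuadrangles k) := by
  obtain ⟨-, h13, h24⟩ := hφ
  -- Four distinct vertices fill a level of four vertices.
  have hsurj : Function.Surjective fun i => (φ (.inl i)).2 := by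
    refine Finite.surjective_of_injective fun i j hij => ?_
    exact Sum.inl_injective (φ.injective (Prod.ext (Fin.ext ((hlast i).trans (hlast j).symm)) hij))
  have hU : ∀ u : Fin (k + 1) × ZMod 4, (∀ i : ZMod 4, u ≠ φ (.inl i)) ↔ u.1.val < k := by
    intro u
    constructor
    · intro h
      by_contra hlt
      obtain ⟨i, hi⟩ := hsurj u.2
      refine h i (Prod.ext (Fin.ext ?_) hi.symm)
      rw [hlast i]
      omega
    · rintro h i rfl
      rw [hlast i] at h
      omega
  have hv : ∀ i, (φ (.inr i)).1.val = k - 1 := by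
    intro i
    have h1 : (φ (.inr i)).1.val < k :=
      (hU _).1 fun j h => Sum.inr_ne_inl (φ.injective h)
    have h2 : (nestedQuadrangles (k + 1)).Adj (φ (.inl i)) (φ (.inr i)) :=
      φ.toHom.map_adj (crossedCube_inl_inr_adj i)
    rw [nestedQuadrangles_adj, Fin.ext_iff, hlast i] at h2
    omega
  have hopp : ∀ i j, i ≠ j → ¬ (nestedQuadrangles (k + 1)).Adj (φ (.inr i)) (φ (.inr j)) →
      (φ (.inr j)).2 = (φ (.inr i)).2 + 2 := by
    intro i j hij hn
    have hl : (φ (.inr i)).1 = (φ (.inr j)).1 := Fin.ext ((hv i).trans (hv j).symm)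
    have hne : (φ (.inr i)).2 ≠ (φ (.inr j)).2 := fun h =>
      hij (Sum.inr_injective (φ.injective (Prod.ext hl h)))
    rw [nestedQuadrangles_adj] at hn
    simp only [hl, true_and, not_or] at hn
    have hZ : ∀ a b : ZMod 4, a ≠ b → b ≠ a + 1 → b ≠ a - 1 → b = a + 2 := by decide
    exact hZ _ _ hne hn.1.1 hn.1.2.1
  have o13 := hopp 1 3 (by decide) h13
  have o24 := hopp 2 4 (by decide) h24
  have h12 : (φ (.inr 1)).2 ≠ (φ (.inr 2)).2 := fun h => absurd (φ.injective
    (Prod.ext (Fin.ext ((hv 1).trans (hv 2).symm)) h)) (by decide)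
  have h14 : (φ (.inr 1)).2 ≠ (φ (.inr 4)).2 := fun h => absurd (φ.injective
    (Prod.ext (Fin.ext ((hv 1).trans (hv 4).symm)) h)) (by decide)
  -- The two added diagonals are disjoint, so together they meet every position of level `k - 1`.
  have hcover : ∀ s t a : ZMod 4, s ≠ t → s ≠ t + 2 → a = s ∨ a = s + 2 ∨ a = t ∨ a = t + 2 := by
    decide
  have hcover := fun a => hcover _ _ a h12 (by rw [← o24]; exact h14)
  let E : {u : Fin (k + 1) × ZMod 4 | ∀ i : ZMod 4, u ≠ φ (.inl i)} ≃ Fin k × ZMod 4 :=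
    { toFun := fun u => (⟨u.1.1.val, (hU u.1).1 u.2⟩, u.1.2)
      invFun := fun w => ⟨(w.1.castSucc, w.2), (hU _).2 w.1.isLt⟩
      left_inv := fun u => rfl
      right_inv := fun w => rfl }
  refine ⟨⟨E, ?_⟩⟩
  rintro ⟨⟨i, a⟩, hu⟩ ⟨⟨j, b⟩, hw⟩
  have hi : i.val < k := (hU _).1 hu
  have hj : j.val < k := (hU _).1 hw
  have hR : (crResult φ).Adj ⟨(i, a), hu⟩ ⟨(j, b), hw⟩ ↔
      (nestedQuadrangles (k + 1)).Adj (i, a) (j, b) ∨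
        ((i.val = k - 1 ∧ j.val = k - 1) ∧ b = a + 2) := by
    have hall : (crResult φ).Adj ⟨(i, a), hu⟩ ⟨(j, b), hw⟩ ↔
        ((nestedQuadrangles (k + 1)).Adj (i, a) (j, b) ∨
          (SimpleGraph.edge (φ (.inr 1)) (φ (.inr 3))).Adj (i, a) (j, b)) ∨
          (SimpleGraph.edge (φ (.inr 2)) (φ (.inr 4))).Adj (i, a) (j, b) := Iff.rfl
    rw [hall, edge_adj_of_opposite (hv 1) (hv 3) o13, edge_adj_of_opposite (hv 2) (hv 4) o24,
      or_assoc, ← and_or_left, ← and_or_left, or_assoc, and_iff_left (hcover a)]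
  rw [hR]
  exact nestedQuadrangles_adj_restrict hk hi hj a b

/-- With at least three levels the two end levels are not consecutive, so pairwise adjacent
candidates share one of them. The innermost level is reduced to the outermost by reversal. -/
lemma nonempty_crResult_iso {k : ℕ} (hk : 2 ≤ k)
    (φ : SimpleGraph.Copy crossedCube (nestedQuadrangles (k + 1))) (hφ : CRFeasible φ) :
    Nonempty (crResult φ ≃g nestedQuadrangles k) := by
  have hend : ∀ i, (φ (.inl i)).1.val = 0 ∨ (φ (.inl i)).1.val = k := fun i =>
    ((isCandidate_nestedQuadrangles_iff (by omega) _).1 (hφ.1 i)).imp_right Nat.succ_injective.eq_iff.1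
  have hsame : ∀ i, (φ (.inl i)).1.val = (φ (.inl 0)).1.val := by
    intro i
    by_cases h : i = 0
    · rw [h]
    · have hadj : (nestedQuadrangles (k + 1)).Adj (φ (.inl i)) (φ (.inl 0)) :=
        φ.toHom.map_adj (crossedCube_inl_adj h)
      rw [nestedQuadrangles_adj, Fin.ext_iff] at hadj
      have := hend i
      have := hend 0
      omega
  rcases hend 0 with h0 | h0
  · obtain ⟨f⟩ := nonempty_crResult_iso_of_last hk (φ.mapIso (reverseLevels (k + 1)))
      (hφ.mapIso _) (fun i => by
        have h : (φ (.inl i)).1.val = 0 := (hsame i).trans h0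
        change (Fin.rev (φ (.inl i)).1).val = k
        rw [Fin.val_rev, h]
        omega)
    exact ⟨(crResultIso φ _).trans f⟩
  · exact nonempty_crResult_iso_of_last hk φ hφ fun i => (hsame i).trans h0

lemma crossedCube_adj_cases {u w : ZMod 4 ⊕ ZMod 4} (h : crossedCube.Adj u w) :
    (∃ i j, i ≠ j ∧ u = .inl i ∧ w = .inl j) ∨
    (∃ i j, j ≠ i + 2 ∧ (u = .inl i ∧ w = .inr j ∨ u = .inr i ∧ w = .inl j)) ∨
    (∃ i j, (j = i + 1 ∨ j = i - 1) ∧ u = .inr i ∧ w = .inr j) := by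
  have h3 : ∀ i j : ZMod 4, (j = i ∨ j = i + 1 ∨ j = i - 1) → j ≠ i + 2 := by decide
  have h3' : ∀ i j : ZMod 4, (j = i ∨ j = i + 1 ∨ j = i - 1) → i ≠ j + 2 := by decide
  have h1 : ∀ i j : ZMod 4, i = j + 1 → j = i - 1 := by decide
  rw [crossedCube, SimpleGraph.fromRel_adj] at h
  obtain ⟨hne, h⟩ := h
  rcases u with i | i <;> rcases w with j | j
  · exact Or.inl ⟨i, j, fun h => hne (by rw [h]), rfl, rfl⟩
  · exact Or.inr (Or.inl ⟨i, j, h3 i j (h.resolve_right id), Or.inl ⟨rfl, rfl⟩⟩)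
  · exact Or.inr (Or.inl ⟨i, j, h3' j i (h.resolve_left id), Or.inr ⟨rfl, rfl⟩⟩)
  · exact Or.inr (Or.inr ⟨i, j, h.imp_right (h1 i j), rfl, rfl⟩)

/-- The crossed cube formed by the two outermost levels. -/
def outerCrossedCube (k : ℕ) (hk : 1 ≤ k) :
    SimpleGraph.Copy crossedCube (nestedQuadrangles (k + 1)) where
  toHom :=
    { toFun := Sum.elim (fun a => (⟨k, by omega⟩, a)) (fun a => (⟨k - 1, by omega⟩, a))
      map_rel' := by
        intro u w h
        have h3 : ∀ i j : ZMod 4, i ≠ j → j = i + 1 ∨ j = i - 1 ∨ j = i + 2 := by decide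
        rcases crossedCube_adj_cases h with ⟨i, j, hij, rfl, rfl⟩ |
          ⟨i, j, hij, ⟨rfl, rfl⟩ | ⟨rfl, rfl⟩⟩ | ⟨i, j, hij, rfl, rfl⟩ <;> rw [nestedQuadrangles_adj]
        · exact Or.inl ⟨rfl, (h3 i j hij).imp_right (Or.imp_right fun h => ⟨Or.inr rfl, h⟩)⟩
        · exact Or.inr ⟨Or.inr (Nat.sub_add_cancel hk), hij⟩
        · exact Or.inr ⟨Or.inl (Nat.sub_add_cancel hk), hij⟩
        · exact Or.inl ⟨rfl, hij.imp_right Or.inl⟩ }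
  injective' := by
    have hne : k ≠ k - 1 := by omega
    rintro (i | i) (j | j) h
    · exact congrArg _ (congrArg Prod.snd h)
    · exact absurd (congrArg (fun u => u.1.val) h) hne
    · exact absurd (congrArg (fun u => u.1.val) h) hne.symm
    · exact congrArg _ (congrArg Prod.snd h)

lemma crFeasible_outerCrossedCube {k : ℕ} (hk : 2 ≤ k) :
    CRFeasible (outerCrossedCube k (by omega)) := by
  have hn : ∀ a : ZMod 4, ¬ (nestedQuadrangles (k + 1)).Adj (⟨k - 1, by omega⟩, a)
      (⟨k - 1, by omega⟩, a + 2) := by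
    intro a h
    have h3 : ∀ a : ZMod 4, a + 2 ≠ a + 1 ∧ a + 2 ≠ a - 1 := by decide
    rw [nestedQuadrangles_adj] at h
    rcases h with ⟨-, h | h | ⟨h | h, -⟩⟩ | ⟨h, -⟩
    · exact (h3 a).1 h
    · exact (h3 a).2 h
    all_goals dsimp only at h; omega
  exact ⟨fun i => (isCandidate_nestedQuadrangles_iff (by omega) _).2 (Or.inr rfl), hn 1, hn 2⟩

/-- The non-edges form a perfect matching and the copy covers all eight vertices. Feasibility would
match the outer vertices among themselves, hence also the inner ones, but these are pairwise
adjacent. -/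
lemma not_crFeasible_nestedQuadrangles_two
    (φ : SimpleGraph.Copy crossedCube (nestedQuadrangles 2)) : ¬ CRFeasible φ := by
  rintro ⟨-, h13, h24⟩
  have hanti : ∀ u w : Fin 2 × ZMod 4, u ≠ w → ¬ (nestedQuadrangles 2).Adj u w →
      w = (u.1 + 1, u.2 + 2) := by
    intro u w
    rw [nestedQuadrangles_adj]
    unfold IsEndLevel
    decide +revert
  have hinv : ∀ u : Fin 2 × ZMod 4, ((u.1 + 1 + 1, u.2 + 2 + 2) : Fin 2 × ZMod 4) = u := by decide
  have hadj : ∀ u : Fin 2 × ZMod 4, ¬ (nestedQuadrangles 2).Adj u (u.1 + 1, u.2 + 2) := by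
    intro u
    rw [nestedQuadrangles_adj]
    unfold IsEndLevel
    decide +revert
  have hself : ∀ u : Fin 2 × ZMod 4, u ≠ (u.1 + 1, u.2 + 2) := by decide
  have hne : ∀ i j : ZMod 4, i ≠ j → φ (.inr i) ≠ φ (.inr j) := fun i j h h' =>
    h (Sum.inr_injective (φ.injective h'))
  have e13 := hanti _ _ (hne 1 3 (by decide)) h13
  have e24 := hanti _ _ (hne 2 4 (by decide)) h24
  have e31 := hanti _ _ (hne 3 1 (by decide)) fun h => h13 h.symm
  have e42 := hanti _ _ (hne 4 2 (by decide)) fun h => h24 h.symm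
  have hbij : Function.Bijective φ := by
    rw [Fintype.bijective_iff_injective_and_card]
    exact ⟨φ.injective, by simp [ZMod.card]⟩
  obtain ⟨z, hz⟩ := hbij.2 ((φ (.inl 0)).1 + 1, (φ (.inl 0)).2 + 2)
  rcases z with i | i
  · by_cases hi : i = 0
    · rw [hi] at hz
      exact hself _ hz
    · refine hadj (φ (.inl 0)) ?_
      rw [← hz]
      exact φ.toHom.map_adj (crossedCube_inl_adj (Ne.symm hi))
  · have hx : φ (.inl 0) = ((φ (.inr i)).1 + 1, (φ (.inr i)).2 + 2) := by
      rw [hz]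
      exact (hinv _).symm
    have hi : ∀ i : ZMod 4, i = 1 ∨ i = 2 ∨ i = 3 ∨ i = 4 := by decide
    rcases hi i with rfl | rfl | rfl | rfl
    · exact Sum.inl_ne_inr (φ.injective (hx.trans e13.symm))
    · exact Sum.inl_ne_inr (φ.injective (hx.trans e24.symm))
    · exact Sum.inl_ne_inr (φ.injective (hx.trans e31.symm))
    · exact Sum.inl_ne_inr (φ.injective (hx.trans e42.symm))

/-! ### Reduction sequences and extended wheels -/

lemma exists_iso_nestedQuadrangles_of_reduces {m : ℕ} (hm : 2 ≤ m) {H : BundledGraph}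
    (h : Reduces ⟨_, nestedQuadrangles m⟩ H) :
    ∃ j, 2 ≤ j ∧ Nonempty (H.graph ≃g nestedQuadrangles j) := by
  induction h with
  | refl => exact ⟨m, hm, ⟨SimpleGraph.Iso.refl⟩⟩
  | tail _ hstep ih =>
    obtain ⟨j, hj, ⟨e⟩⟩ := ih
    rcases hstep with ⟨φ, hφ, -⟩ | ⟨φ, hφ, ⟨f⟩⟩
    · exact absurd (hφ.mapIso e) (not_srFeasible_nestedQuadrangles hj _)
    · obtain rfl | ⟨k, hk, rfl⟩ : j = 2 ∨ ∃ k, 2 ≤ k ∧ j = k + 1 := by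
        rcases Nat.lt_or_ge 2 j with h | h
        · exact Or.inr ⟨j - 1, by omega, by omega⟩
        · exact Or.inl (by omega)
      · exact absurd (hφ.mapIso e) (not_crFeasible_nestedQuadrangles_two _)
      · obtain ⟨g⟩ := nonempty_crResult_iso hk _ (hφ.mapIso e)
        exact ⟨k, hk, ⟨(f.symm.trans (crResultIso φ e)).trans g⟩⟩

/-- $XW_6$ is $K_8$ minus a perfect matching: the non-edges join antipodes of the 6-cycle and the
two poles. -/
lemma extendedWheel_three_adj_iff (u w : ZMod (2 * 3) ⊕ Bool) :
    (extendedWheel 3).Adj u w ↔ u ≠ w ∧ w ≠ Sum.map (· + 3) not u := by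
  have h : ∀ i j : ZMod (2 * 3), (i ≠ j ∧ ((j = i + 1 ∨ j = i + 2) ∨ (i = j + 1 ∨ i = j + 2))) ↔
      i ≠ j ∧ j ≠ i + 3 := by decide
  rw [extendedWheel, SimpleGraph.fromRel_adj]
  rcases u with i | i <;> rcases w with j | j
  · simpa using h i j
  · simp
  · simp
  · cases i <;> cases j <;> simp

/-- The nested crossed quadrangles with two levels form the smallest extended wheel graph. -/
def nestedQuadranglesTwoIso : nestedQuadrangles 2 ≃g extendedWheel 3 where
  -- The non-edges between `(0, a)` and `(1, a + 2)` go to the three antipodal pairs and, for `a =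
  -- 3`, to the pair of poles.
  toFun := fun u => match u with
    | (0, 0) => .inl 0
    | (0, 1) => .inl 1
    | (0, 2) => .inl 2
    | (0, 3) => .inr false
    | (1, 0) => .inl 5
    | (1, 1) => .inr true
    | (1, 2) => .inl 3
    | (1, 3) => .inl 4
  invFun := fun u => match u with
    | .inl 0 => (0, 0)
    | .inl 1 => (0, 1)
    | .inl 2 => (0, 2)
    | .inl 3 => (1, 2)
    | .inl 4 => (1, 3)
    | .inl 5 => (1, 0)
    | .inr false => (0, 3)
    | .inr true => (1, 1)
  left_inv := by decide
  right_inv := by decide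
  map_rel_iff' := by
    intro u w
    rw [nestedQuadrangles_adj, extendedWheel_three_adj_iff]
    unfold IsEndLevel
    decide +revert

lemma eq_three_of_iso_extendedWheel {j k : ℕ} (hj : 2 ≤ j) (hk : 3 ≤ k)
    (e : nestedQuadrangles j ≃g extendedWheel k) : k = 3 := by
  have : NeZero (2 * k) := ⟨by omega⟩
  have hcard : 4 * j = 2 * k + 2 := by
    rw [← nat_card_nestedQuadrangles, Nat.card_congr e.toEquiv, Nat.card_sum, Nat.card_zmod]
    simp
  have hpole : 2 * k ≤ ((extendedWheel k).neighborSet (.inr true)).ncard := by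
    have hsub : Set.range Sum.inl ⊆ (extendedWheel k).neighborSet (.inr true) := by
      rintro _ ⟨i, rfl⟩
      simp [extendedWheel]
    calc 2 * k = (Set.range (Sum.inl : ZMod (2 * k) → ZMod (2 * k) ⊕ Bool)).ncard := by
          rw [Set.ncard_range_of_injective Sum.inl_injective, Nat.card_zmod]
      _ ≤ _ := Set.ncard_le_ncard hsub (Set.toFinite _)
  -- A pole has degree at least `2 * k`, so `k ≤ 4`; the vertex count `4 * j = 2 * k + 2` makes `k`
  -- odd.
  obtain ⟨⟨i, a⟩, hu⟩ := e.surjective (.inr true)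
  rw [← hu, ncard_neighborSet_iso] at hpole
  by_cases hi : IsEndLevel i
  · rw [degree_of_isEndLevel hj hi] at hpole
    omega
  · rw [degree_of_not_isEndLevel hi] at hpole
    omega

lemma exists_crStep_of_iso {k : ℕ} (hk : 2 ≤ k) {H : BundledGraph}
    (e : H.graph ≃g nestedQuadrangles (k + 1)) :
    ∃ H' : BundledGraph, CRStep H H' ∧ Nonempty (H'.graph ≃g nestedQuadrangles k) := by
  have hφ := (crFeasible_outerCrossedCube hk).mapIso e.symm
  -- The copy is carried back along `e`, because the lemma identifies results only inside
  -- `nestedQuadrangles (k + 1)`.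
  obtain ⟨g⟩ := nonempty_crResult_iso hk _ (hφ.mapIso e)
  exact ⟨⟨_, crResult _⟩, ⟨_, hφ, ⟨SimpleGraph.Iso.refl⟩⟩, ⟨(crResultIso _ e).trans g⟩⟩

/-- The quantification over all `H` in the isomorphism class is needed for the induction, as a step
determines its result only up to isomorphism. -/
lemma exists_reduces_iso_nestedQuadrangles_two {m : ℕ} (hm : 2 ≤ m) :
    ∀ H : BundledGraph, Nonempty (H.graph ≃g nestedQuadrangles m) →
      ∃ H' : BundledGraph, Reduces H H' ∧ Nonempty (H'.graph ≃g nestedQuadrangles 2) := by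
  induction m, hm using Nat.le_induction with
  | base => exact fun H h => ⟨H, Relation.ReflTransGen.refl, h⟩
  | succ k hk ih =>
    rintro H ⟨e⟩
    obtain ⟨H₁, hstep, h₁⟩ := exists_crStep_of_iso hk e
    obtain ⟨H₂, hred, h₂⟩ := ih H₁ h₁
    exact ⟨H₂, Relation.ReflTransGen.head (Or.inr hstep) hred, h₂⟩

theorem mainTheorem7 :
    (∀ m : ℕ, 3 ≤ m →
      IsOptimalOnePlanar (nestedQuadrangles m) ∧
      (∃ H : BundledGraph, Reduces ⟨_, nestedQuadrangles m⟩ H ∧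
        Nonempty (H.graph ≃g extendedWheel 3)) ∧
      (∀ k : ℕ, 3 ≤ k → ∀ H : BundledGraph, Reduces ⟨_, nestedQuadrangles m⟩ H →
        Nonempty (H.graph ≃g extendedWheel k) → k = 3) ∧
      (∀ H : BundledGraph, Reduces ⟨_, nestedQuadrangles m⟩ H →
        IsOptimalOnePlanar H.graph ∧
        (∀ H' : BundledGraph, ¬ SRStep H H') ∧
        (Nonempty (H.graph ≃g extendedWheel 3) ∨ ∃ H' : BundledGraph, CRStep H H'))) ∧
    (∀ m m' : ℕ, 3 ≤ m → 3 ≤ m' →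
      Nonempty (nestedQuadrangles m ≃g nestedQuadrangles m') → m = m') := by
  refine ⟨fun m hm => ⟨isOptimalOnePlanar_nestedQuadrangles (by omega), ?_, ?_, ?_⟩, ?_⟩
  · obtain ⟨H, hH, ⟨e⟩⟩ := exists_reduces_iso_nestedQuadrangles_two (m := m) (by omega)
      ⟨_, nestedQuadrangles m⟩ ⟨SimpleGraph.Iso.refl⟩
    exact ⟨H, hH, ⟨e.trans nestedQuadranglesTwoIso⟩⟩
  · rintro k hk H hH ⟨f⟩
    obtain ⟨j, hj, ⟨e⟩⟩ := exists_iso_nestedQuadrangles_of_reduces (by omega) hH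
    exact eq_three_of_iso_extendedWheel hj hk (e.symm.trans f)
  · intro H hH
    obtain ⟨j, hj, ⟨e⟩⟩ := exists_iso_nestedQuadrangles_of_reduces (by omega) hH
    refine ⟨(isOptimalOnePlanar_nestedQuadrangles hj).of_iso e, ?_, ?_⟩
    · rintro H' ⟨φ, hφ, -⟩
      exact not_srFeasible_nestedQuadrangles hj _ (hφ.mapIso e)
    · rcases hj.eq_or_lt with rfl | hlt
      · exact Or.inl ⟨e.trans nestedQuadranglesTwoIso⟩
      · obtain ⟨k, rfl⟩ : ∃ k, j = k + 1 := ⟨j - 1, by omega⟩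
        obtain ⟨H', h, -⟩ := exists_crStep_of_iso (by omega) e
        exact Or.inr ⟨H', h⟩
  · rintro m m' - - ⟨e⟩
    have h := Nat.card_congr e.toEquiv
    rw [nat_card_nestedQuadrangles, nat_card_nestedQuadrangles] at h
    omega
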